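/- All graphs are finite. An oriented graph is a digraph without loops and without opposite arcs. A homomorphism from an oriented graph $\overrightarrow{G}$ to an oriented graph $\overrightarrow{H}$ is a map $\phi$ from the vertices of $\overrightarrow{G}$ to those of $\overrightarrow{H}$ such that $\phi(u)\phi(v)$ is an arc of $\overrightarrow{H}$ for every arc $uv$ of $\overrightarrow{G}$. The oriented chromatic number $\chi_o(\overrightarrow{G})$ is the minimum number of vertices of an oriented graph $\overrightarrow{H}$ to which $\overrightarrow{G}$ admits a homomorphism. For a simple undirected graph $G$, let $\chi_o(G)$ be the maximum of $\chi_o(\overrightarrow{G})$ over all orientations $\overrightarrow{G}$ of $G$. For an integer $\Delta$, let $\mathcal{G}^{c}_{\Delta}$ be the family of connected simple graphs with maximum degree exactly $\Delta$, and let $\chi_o(\mathcal{G}^{c}_{\Delta}) = \max\{\chi_o(G) : G \in \mathcal{G}^{c}_{\Delta}\}$. Theorem. For every integer $\Delta \geq 29$ this maximum exists, and $$2^{\Delta/2} \leq \chi_o(\mathcal{G}^{c}_{\Delta}) \leq (\Delta-3)(\Delta-1)\,2^{\Delta} + 2.$$ -/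

import Mathlib

/-- An oriented graph: a loopless digraph without opposite arcs. -/
def Digraph.IsOriented {V : Type*} (D : Digraph V) : Prop :=
  (∀ v, ¬ D.Adj v v) ∧ ∀ u v, D.Adj u v → ¬ D.Adj v u

/-- `D` is an orientation of the simple graph `G`: it is an oriented graph whose underlying
undirected graph is `G`. -/
def SimpleGraph.IsOrientation {V : Type*} (G : SimpleGraph V) (D : Digraph V) : Prop :=
  D.IsOriented ∧ D.toSimpleGraphInclusive = G

/-- There is a homomorphism from `D` to `H`, i.e. an arc-preserving map of the vertices. -/
def Digraph.HomTo {V W : Type*} (D : Digraph V) (H : Digraph W) : Prop :=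
  ∃ φ : V → W, ∀ u v, D.Adj u v → H.Adj (φ u) (φ v)

/-- The oriented chromatic number of a finite oriented graph `D`: the minimum order of an
oriented graph to which `D` has a homomorphism. -/
noncomputable def Digraph.orientedChromaticNumber {V : Type*} (D : Digraph V) : ℕ :=
  sInf {n : ℕ | ∃ H : Digraph (Fin n), H.IsOriented ∧ D.HomTo H}

/-- The oriented chromatic number of a finite simple graph `G`: the maximum of the oriented
chromatic numbers of the orientations of `G`. -/
noncomputable def SimpleGraph.orientedChromaticNumber {V : Type*} (G : SimpleGraph V) : ℕ :=
  sSup {m : ℕ | ∃ D : Digraph V, G.IsOrientation D ∧ m = D.orientedChromaticNumber}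

open Classical in
/-- The values `χ_o(G)`, where `G` ranges over the finite connected graphs of maximum
degree exactly `Δ`. -/
def connectedOrientedChromaticNumbers (Δ : ℕ) : Set ℕ :=
  {m : ℕ | ∃ (V : Type) (_ : Fintype V) (G : SimpleGraph V),
    G.Connected ∧ G.maxDegree = Δ ∧ m = G.orientedChromaticNumber}

/-- For a finite oriented graph the minimum defining its oriented chromatic number is over a
nonempty set, hence is attained. -/
theorem Digraph.IsOriented.isLeast_orientedChromaticNumber {V : Type*} [Fintype V]
    {D : Digraph V} (hD : D.IsOriented) :
    IsLeast {n : ℕ | ∃ H : Digraph (Fin n), H.IsOriented ∧ D.HomTo H}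
      D.orientedChromaticNumber := by
  have hne : {n : ℕ | ∃ H : Digraph (Fin n), H.IsOriented ∧ D.HomTo H}.Nonempty := by
    let e := Fintype.equivFin V
    refine ⟨Fintype.card V, ⟨fun a b => D.Adj (e.symm a) (e.symm b)⟩,
      ⟨fun v => hD.1 _, fun u v => hD.2 _ _⟩, e, fun u v h => ?_⟩
    simpa using h
  exact ⟨Nat.sInf_mem hne, fun n hn => Nat.sInf_le hn⟩

/-- For a finite graph the maximum defining its oriented chromatic number is over a nonempty
finite set, hence is attained. -/
theorem SimpleGraph.isGreatest_orientedChromaticNumber {V : Type*} [Fintype V]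
    (G : SimpleGraph V) :
    IsGreatest {m : ℕ | ∃ D : Digraph V, G.IsOrientation D ∧ m = D.orientedChromaticNumber}
      G.orientedChromaticNumber := by
  have hne : {m : ℕ | ∃ D : Digraph V,
      G.IsOrientation D ∧ m = D.orientedChromaticNumber}.Nonempty := by
    let e := Fintype.equivFin V
    refine ⟨_, ⟨fun a b => G.Adj a b ∧ e a < e b⟩,
      ⟨⟨fun v h => G.loopless.irrefl _ h.1, fun u v h h' => lt_asymm h.2 h'.2⟩, ?_⟩, rfl⟩
    ext u v
    simp only [Digraph.toSimpleGraphInclusive, SimpleGraph.fromRel_adj]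
    constructor
    · rintro ⟨-, h | h⟩
      exacts [h.1, h.1.symm]
    · intro h
      refine ⟨h.ne, ?_⟩
      rcases lt_or_gt_of_ne (e.injective.ne h.ne) with h' | h'
      exacts [Or.inl ⟨h, h'⟩, Or.inr ⟨h.symm, h'⟩]
  have hfin : {m : ℕ | ∃ D : Digraph V,
      G.IsOrientation D ∧ m = D.orientedChromaticNumber}.Finite := by
    classical
    refine (Set.finite_range fun D : Digraph V => D.orientedChromaticNumber).subset ?_
    rintro m ⟨D, -, rfl⟩
    exact ⟨D, rfl⟩
  exact ⟨Nat.sSup_mem hne hfin.bddAbove, fun m hm => le_csSup hfin.bddAbove hm⟩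

/-! Upper bound: put `k = Δ - 1` and `n = (Δ - 3)(Δ - 1) 2 ^ Δ`. In some tournament on `n` vertices,
found by a union bound, each in/out pattern on `k` vertices has more than `k` extensions
(`exists_tournament_lt_card_patternExtensions`), hence each pattern on `k - j` vertices has at least
`(j + 1)(k + 1)` (`le_card_patternExtensions`). With this room, any orientation of `G` minus a root
can be mapped greedily into the tournament, from the farthest vertices inwards, keeping the coloured
neighbours of each uncoloured vertex distinct (`exists_partial_coloring`). The root receives one
extra colour.

Lower bound: a homomorphism together with its target determines an orientation, so `c` colours serve
at most `c ^ n * 2 ^ (c * c)` orientations (`two_pow_card_edgeFinset_le`). A `Δ`-regular graph on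
`n` vertices has `2 ^ (n * Δ / 2)` of them; connected ones exist with `n` arbitrarily large, which
forces `2 ^ Δ ≤ c ^ 2`. -/

/-! ### Random tournaments with many pattern extensions. -/

/-- The tournament on `V` obtained from a Boolean matrix: `u → v` iff the value at `(u, v)` is
`true`. -/
def tournamentOfMatrix {V : Type*} [LinearOrder V] (ω : V → V → Bool) (u v : V) : Bool :=
  (ω u v ^^ ω v u) ^^ decide (u < v)

theorem tournamentOfMatrix_swap {V : Type*} [LinearOrder V] (ω : V → V → Bool) {u v : V}
    (h : u ≠ v) : tournamentOfMatrix ω v u = !tournamentOfMatrix ω u v := by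
  unfold tournamentOfMatrix
  rcases lt_or_gt_of_ne h with h | h
  · rw [decide_eq_true h, decide_eq_false (not_lt_of_gt h)]
    cases ω u v <;> cases ω v u <;> rfl
  · rw [decide_eq_true h, decide_eq_false (not_lt_of_gt h)]
    cases ω u v <;> cases ω v u <;> rfl

/-- The vertices outside `A` dominated by the vertices of `B` and by no vertex of `A \ B`. -/
def patternExtensions {V : Type*} [Fintype V] [DecidableEq V] (D : V → V → Bool)
    (A B : Finset V) : Finset V :=
  Aᶜ.filter fun x => ∀ a ∈ A, (D a x = true ↔ a ∈ B)

theorem card_filter_forall_mem_eq {V : Type*} [Fintype V] [DecidableEq V] (A : Finset V)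
    (c : V → Bool) :
    ((Finset.univ : Finset (V → Bool)).filter fun r => ∀ a ∈ A, r a = c a).card
      = 2 ^ (Fintype.card V - A.card) := by
  have h : ((Finset.univ : Finset (V → Bool)).filter fun r => ∀ a ∈ A, r a = c a)
      = Fintype.piFinset fun a => if a ∈ A then {c a} else Finset.univ := by
    ext r
    simp only [Finset.mem_filter, Finset.mem_univ, true_and, Fintype.mem_piFinset]
    refine forall_congr' fun a => ?_
    by_cases ha : a ∈ A <;> simp [ha]
  rw [h, Fintype.card_piFinset]
  simp only [apply_ite Finset.card, Finset.card_singleton, Finset.card_univ, Fintype.card_bool]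
  rw [Finset.prod_ite, Finset.prod_const_one, one_mul, Finset.prod_const, ← Finset.card_compl]
  congr 2
  ext; simp

theorem sum_ite_forall_mem_eq {V : Type*} [Fintype V] [DecidableEq V] (A : Finset V)
    (c : V → Bool) (z : ℝ) :
    ∑ r : V → Bool, (if ∀ a ∈ A, r a = c a then z else 1)
      = 2 ^ Fintype.card V * (1 - (1 - z) / 2 ^ A.card) := by
  have h : ∀ r : V → Bool, (if ∀ a ∈ A, r a = c a then z else 1)
      = 1 - (1 - z) * (if ∀ a ∈ A, r a = c a then 1 else 0) := by
    intro r; split_ifs <;> ring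
  simp_rw [h]
  rw [Finset.sum_sub_distrib, ← Finset.mul_sum, Finset.sum_boole, card_filter_forall_mem_eq]
  have h2 : (2 : ℝ) ^ Fintype.card V = 2 ^ (Fintype.card V - A.card) * 2 ^ A.card := by
    rw [← pow_add, Nat.sub_add_cancel (Finset.card_le_univ A)]
  simp only [Finset.sum_const, Finset.card_univ, Fintype.card_fun, Fintype.card_bool,
    nsmul_eq_mul, mul_one]
  push_cast
  rw [mul_sub, h2]
  field_simp

/-- The generating function of the number of extensions of a pattern in a random tournament. -/
theorem sum_pow_card_patternExtensions {V : Type*} [Fintype V] [LinearOrder V] (A B : Finset V)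
    (z : ℝ) :
    ∑ ω : V → V → Bool, z ^ (patternExtensions (tournamentOfMatrix ω) A B).card
      = Fintype.card (V → V → Bool)
        * (1 - (1 - z) / 2 ^ A.card) ^ (Fintype.card V - A.card) := by
  classical
  -- Fix the rows indexed by `A`. Whether `x ∉ A` extends the pattern then depends on row `x` alone,
  -- so the sum factors over `x`.
  let e := Equiv.piEquivPiSubtypeProd (fun x => x ∈ A) (fun _ : V => V → Bool)
  rw [← e.symm.sum_comp, Fintype.sum_prod_type]
  have key : ∀ (α : {x // x ∈ A} → V → Bool),
      ∑ β : {x // x ∉ A} → V → Bool,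
        z ^ (patternExtensions (tournamentOfMatrix (e.symm (α, β))) A B).card
      = (2 ^ Fintype.card V * (1 - (1 - z) / 2 ^ A.card)) ^ (Fintype.card V - A.card) := by
    intro α
    -- The values that row `x` must take on `A`; those off `A` are irrelevant.
    let c : {x // x ∉ A} → V → Bool := fun x a =>
      if h : a ∈ A then (decide (a ∈ B) ^^ α ⟨a, h⟩ x) ^^ decide (a < x) else false
    have h1 : ∀ β : {x // x ∉ A} → V → Bool,
        z ^ (patternExtensions (tournamentOfMatrix (e.symm (α, β))) A B).card
          = ∏ x : {x // x ∉ A}, if ∀ a ∈ A, β x a = c x a then z else 1 := by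
      intro β
      rw [patternExtensions, ← Finset.prod_const, Finset.prod_filter,
        Finset.prod_subtype (p := fun x => x ∉ A) Aᶜ (by simp)]
      refine Finset.prod_congr rfl fun x _ => ?_
      refine if_congr (forall₂_congr fun a ha => ?_) rfl rfl
      have e1 : e.symm (α, β) a = α ⟨a, ha⟩ := by
        simp [e, Equiv.piEquivPiSubtypeProd, ha]
      have e2 : e.symm (α, β) x = β x := by
        simp [e, Equiv.piEquivPiSubtypeProd, x.2]
      simp only [tournamentOfMatrix, e1, e2, c, dif_pos ha]
      by_cases hb : a ∈ B <;> simp only [hb] <;> cases α ⟨a, ha⟩ x <;> cases β x a <;>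
        cases decide (a < (x : V)) <;> simp
    simp_rw [h1]
    rw [← Fintype.prod_sum (fun (x : {x // x ∉ A}) (r : V → Bool) =>
      if ∀ a ∈ A, r a = c x a then z else 1)]
    simp_rw [sum_ite_forall_mem_eq]
    rw [Finset.prod_const, Finset.card_univ, Fintype.card_subtype_compl]
    simp
  simp_rw [key]
  rw [Finset.sum_const, Finset.card_univ, nsmul_eq_mul, mul_pow, ← mul_assoc]
  congr 1
  rw [Fintype.card_congr e, Fintype.card_prod]
  push_cast
  congr 1
  simp [Fintype.card_subtype_compl]

/-- Markov's inequality for `(1/4) ^ X`, with `X` the number of extensions, and a union bound. The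
`8` is `4 * 2`: `4 ^ k` from Markov, `2 ^ k` from the choices of `B`. -/
theorem exists_tournament_lt_card_patternExtensions {V : Type*} [Fintype V] [LinearOrder V]
    {k : ℕ}
    (h : (8 * Fintype.card V : ℝ) ^ k
      * (1 - (3 / 4) / 2 ^ k) ^ (Fintype.card V - k) < 1) :
    ∃ ω : V → V → Bool, ∀ A B : Finset V, A.card = k → B ⊆ A →
      k < (patternExtensions (tournamentOfMatrix ω) A B).card := by
  classical
  by_contra! hcon
  set q : ℝ := (1 - (3 / 4) / 2 ^ k) ^ (Fintype.card V - k) with hq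
  have hq0 : 0 ≤ q := by
    refine pow_nonneg ?_ _
    have : (1 : ℝ) ≤ 2 ^ k := one_le_pow₀ (by norm_num)
    have : (3 / 4 : ℝ) / 2 ^ k ≤ 1 := by rw [div_le_one (by positivity)]; linarith
    linarith
  let P := (Finset.univ : Finset V).powersetCard k
  let f : (V → V → Bool) → Finset V → Finset V → ℝ := fun ω A B =>
    (1 / 4) ^ (patternExtensions (tournamentOfMatrix ω) A B).card
  have h1 : ∀ ω : V → V → Bool, (1 / 4 : ℝ) ^ k ≤ ∑ A ∈ P, ∑ B ∈ A.powerset, f ω A B := by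
    intro ω
    obtain ⟨A, B, hA, hB, hAB⟩ := hcon ω
    have hf : ∀ A B, 0 ≤ f ω A B := fun A B => by positivity
    calc (1 / 4 : ℝ) ^ k ≤ f ω A B := pow_le_pow_of_le_one (by norm_num) (by norm_num) hAB
      _ ≤ ∑ B ∈ A.powerset, f ω A B :=
        Finset.single_le_sum (f := fun B => f ω A B) (fun _ _ => hf _ _)
          (Finset.mem_powerset.2 hB)
      _ ≤ _ := Finset.single_le_sum (f := fun A => ∑ B ∈ A.powerset, f ω A B)
          (fun _ _ => Finset.sum_nonneg fun _ _ => hf _ _)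
          (Finset.mem_powersetCard.2 ⟨Finset.subset_univ _, hA⟩)
  have h2 := Finset.sum_le_sum fun ω (_ : ω ∈ Finset.univ) => h1 ω
  have h3 : ∀ A ∈ P, ∑ ω : V → V → Bool, ∑ B ∈ A.powerset, f ω A B
      = 2 ^ k * (Fintype.card (V → V → Bool) * q) := by
    intro A hA
    have hA := (Finset.mem_powersetCard.1 hA).2
    rw [Finset.sum_comm]
    simp only [f]
    simp_rw [sum_pow_card_patternExtensions, hA]
    rw [Finset.sum_const, Finset.card_powerset, hA, nsmul_eq_mul, hq]
    norm_num
  rw [Finset.sum_comm, Finset.sum_congr rfl h3] at h2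
  rw [Finset.sum_const, Finset.sum_const, Finset.card_powersetCard, Finset.card_univ,
    Finset.card_univ, nsmul_eq_mul, nsmul_eq_mul] at h2
  have hM : (0 : ℝ) < Fintype.card (V → V → Bool) := by exact_mod_cast Fintype.card_pos
  have h4 : ((Fintype.card V).choose k : ℝ) ≤ (Fintype.card V : ℝ) ^ k := by
    exact_mod_cast Nat.choose_le_pow _ _
  set M : ℝ := (Fintype.card (V → V → Bool) : ℝ)
  have h5 : M * (1 / 4) ^ k ≤ M * ((Fintype.card V : ℝ) ^ k * (2 ^ k * q)) := by
    refine h2.trans ?_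
    calc _ ≤ (Fintype.card V : ℝ) ^ k * (2 ^ k * (M * q)) := by gcongr
      _ = _ := by ring
  have h6 := le_of_mul_le_mul_left h5 hM
  have h7 : (4 : ℝ) ^ k * (1 / 4) ^ k = 1 := by rw [← mul_pow]; norm_num
  have h8 : (8 * Fintype.card V : ℝ) ^ k = 4 ^ k * 2 ^ k * (Fintype.card V : ℝ) ^ k := by
    rw [← mul_pow, ← mul_pow]; norm_num
  have h9 : (4 : ℝ) ^ k * (1 / 4) ^ k ≤ 4 ^ k * ((Fintype.card V : ℝ) ^ k * (2 ^ k * q)) := by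
    gcongr
  rw [h8] at h
  linarith

/-- Adding a vertex to `A` splits the pattern into two with disjoint sets of extensions, and `2(j +
1) ≥ j + 2`. -/
theorem le_card_patternExtensions {V : Type*} [Fintype V] [DecidableEq V] {D : V → V → Bool}
    {k : ℕ} (hk : k ≤ Fintype.card V)
    (hD : ∀ A B : Finset V, A.card = k → B ⊆ A → k < (patternExtensions D A B).card)
    (j : ℕ) : ∀ A B : Finset V, A.card + j = k → B ⊆ A →
      (j + 1) * (k + 1) ≤ (patternExtensions D A B).card := by
  induction j with
  | zero => intro A B hA hB; have := hD A B (by omega) hB; omega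
  | succ j ih =>
    intro A B hA hB
    obtain ⟨v, hv⟩ : ∃ v, v ∉ A := by
      by_contra! h
      have := Finset.card_univ (α := V)
      rw [← Finset.eq_univ_iff_forall.2 h] at this
      omega
    have hvB : v ∉ B := fun h => hv (hB h)
    have hc : (insert v A).card + j = k := by rw [Finset.card_insert_of_notMem hv]; omega
    have i1 := ih (insert v A) B hc (hB.trans (Finset.subset_insert _ _))
    have i2 := ih (insert v A) (insert v B) hc (Finset.insert_subset_insert _ hB)
    have hdisj : Disjoint (patternExtensions D (insert v A) B)
        (patternExtensions D (insert v A) (insert v B)) := by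
      rw [Finset.disjoint_left]
      intro x h1 h2
      have h1 := (Finset.mem_filter.1 h1).2 v (Finset.mem_insert_self _ _)
      have h2 := (Finset.mem_filter.1 h2).2 v (Finset.mem_insert_self _ _)
      exact hvB (h1.1 (h2.2 (Finset.mem_insert_self _ _)))
    have hsub : patternExtensions D (insert v A) B ∪ patternExtensions D (insert v A) (insert v B)
        ⊆ patternExtensions D A B := by
      intro x hx
      simp only [patternExtensions, Finset.mem_union, Finset.mem_filter, Finset.mem_compl,
        Finset.mem_insert, not_or] at hx ⊢
      rcases hx with ⟨⟨-, h0⟩, h⟩ | ⟨⟨-, h0⟩, h⟩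
      · exact ⟨h0, fun a ha => h a (Or.inr ha)⟩
      · refine ⟨h0, fun a ha => (h a (Or.inr ha)).trans ?_⟩
        have : a ≠ v := fun h => hv (h ▸ ha)
        simp [this]
    have := Finset.card_le_card hsub
    rw [Finset.card_union_of_disjoint hdisj] at this
    nlinarith

/-! ### Numerical check of the union bound. -/

theorem four_le_exp_three_halves : (4 : ℝ) ≤ Real.exp (3 / 2) := by
  have h1 := Real.exp_one_gt_d9
  have h2 : Real.exp (3 / 2) ^ 2 = Real.exp 1 ^ 3 := by
    rw [← Real.exp_nat_mul, ← Real.exp_nat_mul]; norm_num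
  have h3 : (2.7 : ℝ) ^ 3 ≤ Real.exp 1 ^ 3 := by gcongr; linarith
  have h4 := Real.exp_pos (3 / 2)
  by_contra! h
  have : Real.exp (3 / 2) ^ 2 < 4 ^ 2 := by gcongr
  have h5 : (4 : ℝ) ^ 2 < 2.7 ^ 3 := by norm_num
  linarith

theorem mul_mul_add_two_lt_two_pow {m : ℕ} (hm : 26 ≤ m) : 192 * (m * (m + 2)) < 2 ^ m := by
  induction m, hm using Nat.le_induction with
  | base => norm_num
  | succ m hm ih => rw [pow_succ]; nlinarith

/-- By `1 - y ≤ exp (-y)` the product is at most the `(m + 2)`-th power of `8 n exp (1 - 3m/2)`,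
where `n` is the order of the tournament. As `e < 3` and `exp (3/2) ≥ 4`, this base is below `1`
once `192 m (m + 2) < 2 ^ m`. -/
theorem pow_mul_one_sub_pow_lt_one {m : ℕ} (hm : 26 ≤ m) :
    (8 * (m * (m + 2) * 2 ^ (m + 3) : ℕ) : ℝ) ^ (m + 2)
      * (1 - (3 / 4) / 2 ^ (m + 2)) ^ (m * (m + 2) * 2 ^ (m + 3) - (m + 2)) < 1 := by
  have hkn : m + 2 ≤ m * (m + 2) * 2 ^ (m + 3) := by
    have : 1 ≤ m * 2 ^ (m + 3) := Nat.mul_pos (by omega) (by positivity)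
    calc m + 2 ≤ (m * 2 ^ (m + 3)) * (m + 2) := Nat.le_mul_of_pos_left _ this
      _ = _ := by ring
  have hp : (1 : ℝ) ≤ 2 ^ (m + 2) := one_le_pow₀ (by norm_num)
  have hy : (3 / 4 : ℝ) / 2 ^ (m + 2) ≤ 1 := by rw [div_le_one (by positivity)]; linarith
  have h1 : (1 - (3 / 4 : ℝ) / 2 ^ (m + 2)) ^ (m * (m + 2) * 2 ^ (m + 3) - (m + 2))
      ≤ Real.exp (-((3 / 2) * m - 1)) ^ (m + 2) := by
    calc _ ≤ Real.exp (-((3 / 4 : ℝ) / 2 ^ (m + 2))) ^ (m * (m + 2) * 2 ^ (m + 3) - (m + 2)) := by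
          exact pow_le_pow_left₀ (by linarith) (Real.one_sub_le_exp_neg _) _
      _ ≤ _ := by
          rw [← Real.exp_nat_mul, ← Real.exp_nat_mul, Real.exp_le_exp, Nat.cast_sub hkn]
          push_cast
          have e1 : ((m : ℝ) * (m + 2) * 2 ^ (m + 3) - (m + 2)) * -(3 / 4 / 2 ^ (m + 2))
              = (m + 2) * (-(3 / 2 * m) + (3 / 4) / 2 ^ (m + 2)) := by
            rw [pow_succ 2 (m + 2)]
            field_simp
            ring
          rw [e1]
          gcongr
          linarith
  have h2 : (8 * (m * (m + 2) * 2 ^ (m + 3) : ℕ) : ℝ) * Real.exp (-((3 / 2) * m - 1)) < 1 := by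
    have a1 : Real.exp (-((3 / 2) * m - 1)) = Real.exp 1 / Real.exp (3 / 2) ^ m := by
      rw [← Real.exp_nat_mul, ← Real.exp_sub]; congr 1; ring
    have a2 : (4 : ℝ) ^ m ≤ Real.exp (3 / 2) ^ m := by gcongr; exact four_le_exp_three_halves
    have a3 : Real.exp 1 < 3 := Real.exp_one_lt_three
    have a4 : (192 * (m * (m + 2)) : ℝ) < 2 ^ m := by
      exact_mod_cast mul_mul_add_two_lt_two_pow hm
    have a5 : (4 : ℝ) ^ m = 2 ^ m * 2 ^ m := by rw [← mul_pow]; norm_num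
    rw [a1, ← mul_div_assoc, div_lt_one (by positivity)]
    refine lt_of_lt_of_le ?_ a2
    rw [a5]
    calc _ ≤ (8 * (m * (m + 2) * 2 ^ (m + 3) : ℕ) : ℝ) * 3 := by gcongr
      _ = (192 * (m * (m + 2))) * 2 ^ m := by push_cast; ring
      _ < _ := by gcongr
  calc _ ≤ (8 * (m * (m + 2) * 2 ^ (m + 3) : ℕ) : ℝ) ^ (m + 2)
        * Real.exp (-((3 / 2) * m - 1)) ^ (m + 2) := by gcongr
    _ = ((8 * (m * (m + 2) * 2 ^ (m + 3) : ℕ) : ℝ) * Real.exp (-((3 / 2) * m - 1))) ^ (m + 2) :=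
        (mul_pow _ _ _).symm
    _ < 1 := pow_lt_one₀ (by positivity) h2 (by omega)

/-! ### Greedy colouring towards a root. -/

theorem SimpleGraph.Connected.exists_adj_dist_lt {V : Type*} {G : SimpleGraph V}
    (hG : G.Connected) {r v : V} (h : v ≠ r) : ∃ p, G.Adj v p ∧ G.dist r p < G.dist r v := by
  obtain ⟨w, hw⟩ := hG.exists_walk_length_eq_dist v r
  cases w with
  | nil => exact absurd rfl h
  | @cons _ p _ hadj w =>
    refine ⟨p, hadj, ?_⟩
    rw [SimpleGraph.dist_comm, G.dist_comm (u := r), ← hw, SimpleGraph.Walk.length_cons]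
    exact Nat.lt_succ_of_le (SimpleGraph.dist_le w)

theorem SimpleGraph.IsOrientation.adj_iff {V : Type*} {G : SimpleGraph V} {D : Digraph V}
    (h : G.IsOrientation D) {u v : V} : G.Adj u v ↔ D.Adj u v ∨ D.Adj v u := by
  rw [← h.2, Digraph.toSimpleGraphInclusive, SimpleGraph.fromRel_adj]
  refine ⟨And.right, fun h' => ⟨?_, h'⟩⟩
  rintro rfl
  exact h.1.1 u (h'.elim id id)

theorem Digraph.IsOriented.orientedChromaticNumber_le_card {V W : Type*} [Fintype W]
    {D : Digraph V} {H : Digraph W} (hH : H.IsOriented) (h : D.HomTo H) :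
    D.orientedChromaticNumber ≤ Fintype.card W := by
  obtain ⟨φ, hφ⟩ := h
  let e := Fintype.equivFin W
  refine Nat.sInf_le ⟨⟨fun a b => H.Adj (e.symm a) (e.symm b)⟩,
    ⟨fun v => hH.1 _, fun u v => hH.2 _ _⟩, fun v => e (φ v), fun u v huv => ?_⟩
  simpa using hφ u v huv

theorem exists_partial_coloring {V W : Type*} [Fintype V] [DecidableEq V] [Fintype W]
    [DecidableEq W] {G : SimpleGraph V} [DecidableRel G.Adj] (hG : G.Connected)
    {D : Digraph V} (hD : G.IsOrientation D) {k : ℕ} (hdeg : ∀ v, G.degree v ≤ k + 1)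
    {T : W → W → Bool} (hT : ∀ u v, u ≠ v → T v u = !T u v)
    (hext : ∀ (j : ℕ) (A B : Finset W), A.card + j = k → B ⊆ A →
      (j + 1) * (k + 1) ≤ (patternExtensions T A B).card) (r : V) :
    ∃ φ : V → W, (∀ u v, u ≠ r → v ≠ r → D.Adj u v → φ u ≠ φ v ∧ T (φ u) (φ v) = true) ∧
      Set.InjOn φ (G.neighborSet r) := by
  classical
  have hW : Nonempty W := by
    have := hext k ∅ ∅ (by simp) (by simp)
    obtain ⟨x, -⟩ := Finset.card_pos.1 (lt_of_lt_of_le (by positivity) this)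
    exact ⟨x⟩
  -- Here `s` is the set of coloured vertices; injectivity around every uncoloured vertex makes its
  -- pattern well defined when its turn comes.
  suffices h : ∀ s : Finset V, r ∉ s → ∃ φ : V → W,
      (∀ u ∈ s, ∀ v ∈ s, D.Adj u v → φ u ≠ φ v ∧ T (φ u) (φ v) = true) ∧
      ∀ w, w ∉ s → Set.InjOn φ (G.neighborFinset w ∩ s : Finset V) by
    obtain ⟨φ, h1, h2⟩ := h (Finset.univ.erase r) (by simp)
    refine ⟨φ, fun u v hu hv => h1 u (by simp [hu]) v (by simp [hv]),
      (h2 r (by simp)).mono fun v hv => ?_⟩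
    have hv : G.Adj r v := hv
    simp [hv, hv.ne']
  intro s
  induction s using Finset.induction_on_min_value (G.dist r) with
  | empty => intro _; exact ⟨fun _ => hW.some, by simp, by simp⟩
  | insert a s ha hmin ih =>
    intro hr
    obtain ⟨φ, h1, h2⟩ := ih fun h => hr (Finset.mem_insert_of_mem h)
    have har : a ≠ r := fun h => hr (h ▸ Finset.mem_insert_self _ _)
    obtain ⟨p, hap, hp⟩ := hG.exists_adj_dist_lt har
    have hps : p ∉ s := fun h => absurd (hmin p h) (not_le.2 hp)
    set C := G.neighborFinset a ∩ s with hC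
    set U := G.neighborFinset a \ s with hU
    -- The neighbour `p` closer to the root is still uncoloured, so `C.card ≤ k` and `k - C.card` is
    -- not truncated.
    have hUpos : 0 < U.card := Finset.card_pos.2 ⟨p, by simp [hU, hap, hps]⟩
    have hCU : C.card + U.card ≤ k + 1 := by
      rw [hC, hU, Finset.card_inter_add_card_sdiff]
      exact hdeg a
    have hinj : Set.InjOn φ C := h2 a ha
    have hcardC : (C.image φ).card = C.card := Finset.card_image_of_injOn hinj
    set B := (C.filter fun c => D.Adj c a).image φ with hB
    have hx := hext (k - C.card) (C.image φ) B (by omega)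
      (Finset.image_subset_image (Finset.filter_subset _ _))
    -- Colours that would clash with `a` around an uncoloured neighbour `w`: at most `k` per `w`,
    -- since `a` itself is uncoloured.
    set F := U.biUnion fun w => (G.neighborFinset w ∩ s).image φ with hF
    have hFcard : F.card ≤ U.card * k := by
      refine Finset.card_biUnion_le_card_mul _ _ _ fun w hw => ?_
      have hwa : G.Adj a w := by simpa using (Finset.mem_sdiff.1 hw).1
      refine Finset.card_image_le.trans ?_
      have : G.neighborFinset w ∩ s ⊆ (G.neighborFinset w).erase a := by
        intro v hv
        obtain ⟨h1, h2⟩ := Finset.mem_inter.1 hv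
        exact Finset.mem_erase.2 ⟨fun h => ha (h ▸ h2), h1⟩
      have := Finset.card_le_card this
      rw [Finset.card_erase_of_mem (by simpa using hwa.symm)] at this
      have := hdeg w
      rw [← SimpleGraph.card_neighborFinset_eq_degree] at this
      omega
    obtain ⟨t, ht, htF⟩ : ∃ t ∈ patternExtensions T (C.image φ) B, t ∉ F := by
      apply Finset.exists_mem_notMem_of_card_lt_card
      refine lt_of_lt_of_le ?_ hx
      have : U.card ≤ k - C.card + 1 := by omega
      calc F.card ≤ U.card * k := hFcard
        _ ≤ (k - C.card + 1) * k := Nat.mul_le_mul_right _ this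
        _ < _ := Nat.mul_lt_mul_of_pos_left (Nat.lt_succ_self k) (Nat.succ_pos _)
    simp only [patternExtensions, Finset.mem_filter, Finset.mem_compl] at ht
    obtain ⟨ht1, ht2⟩ := ht
    have hne : ∀ c ∈ C, φ c ≠ t := fun c hc h => ht1 (h ▸ Finset.mem_image_of_mem _ hc)
    have hpat : ∀ c ∈ C, (T (φ c) t = true ↔ D.Adj c a) := by
      intro c hc
      rw [ht2 _ (Finset.mem_image_of_mem _ hc), hB, Finset.mem_image]
      constructor
      · rintro ⟨c', hc', he⟩
        obtain ⟨h3, h4⟩ := Finset.mem_filter.1 hc'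
        rwa [← hinj h3 hc he]
      · exact fun h => ⟨c, Finset.mem_filter.2 ⟨hc, h⟩, rfl⟩
    have hup : ∀ v ∈ s, Function.update φ a t v = φ v := by
      rintro v hv
      exact Function.update_of_ne (by rintro rfl; exact ha hv) _ _
    have hCmem : ∀ v ∈ s, G.Adj a v → v ∈ C := fun v hv h => by simp [hC, hv, h]
    refine ⟨Function.update φ a t, ?_, ?_⟩
    · intro u hu' v hv' huv
      rcases Finset.mem_insert.1 hu' with rfl | hu <;> rcases Finset.mem_insert.1 hv' with rfl | hv
      · exact absurd huv (hD.1.1 _)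
      · have hvC := hCmem v hv (hD.adj_iff.2 (Or.inl huv))
        rw [hup v hv, Function.update_self]
        refine ⟨(hne v hvC).symm, ?_⟩
        rw [hT _ _ (hne v hvC), Bool.not_eq_true', Bool.eq_false_iff, Ne, hpat v hvC]
        exact hD.1.2 _ _ huv
      · have huC := hCmem u hu (hD.adj_iff.2 (Or.inr huv))
        rw [hup u hu, Function.update_self]
        exact ⟨hne u huC, (hpat u huC).2 huv⟩
      · rw [hup u hu, hup v hv]
        exact h1 u hu v hv huv
    · intro w hw
      have hws : w ∉ s := fun h => hw (Finset.mem_insert_of_mem h)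
      have hcol : ∀ v ∈ s, G.Adj w v → G.Adj w a → φ v ≠ t := by
        intro v hv hwv hwa h
        refine htF (Finset.mem_biUnion.2 ⟨w, ?_, Finset.mem_image.2 ⟨v, ?_, h⟩⟩)
        · simp [hU, hwa.symm, hws]
        · simp [hv, hwv]
      intro u hu v hv huv
      simp only [Finset.mem_coe, Finset.mem_inter, SimpleGraph.mem_neighborFinset] at hu hv
      obtain ⟨hwu, hu'⟩ := hu
      obtain ⟨hwv, hv'⟩ := hv
      rcases Finset.mem_insert.1 hu' with rfl | hu <;> rcases Finset.mem_insert.1 hv' with rfl | hv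
      · rfl
      · rw [hup v hv, Function.update_self] at huv
        exact absurd huv.symm (hcol v hv hwv hwu)
      · rw [hup u hu, Function.update_self] at huv
        exact absurd huv (hcol u hu hwu hwv)
      · rw [hup u hu, hup v hv] at huv
        exact h2 w hws (by simp [hwu, hu]) (by simp [hwv, hv]) huv

theorem orientedChromaticNumber_le_card_add_one {V W : Type*} [Fintype V] [Fintype W]
    [DecidableEq W] {G : SimpleGraph V} [DecidableRel G.Adj] (hG : G.Connected)
    {k : ℕ} (hdeg : ∀ v, G.degree v ≤ k + 1)
    {T : W → W → Bool} (hT : ∀ u v, u ≠ v → T v u = !T u v)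
    (hext : ∀ (j : ℕ) (A B : Finset W), A.card + j = k → B ⊆ A →
      (j + 1) * (k + 1) ≤ (patternExtensions T A B).card) :
    G.orientedChromaticNumber ≤ Fintype.card W + 1 := by
  classical
  obtain ⟨D, hD, hχ⟩ := G.isGreatest_orientedChromaticNumber.1
  rw [hχ, ← Fintype.card_option]
  obtain ⟨r⟩ := hG.nonempty
  obtain ⟨φ, h1, h2⟩ := exists_partial_coloring hG hD hdeg hT hext r
  -- The root is sent to `none`. Distinct colours on its neighbours prevent opposite arcs there.
  let H : Digraph (Option W) := ⟨fun x y => match x, y with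
    | none, none => False
    | none, some y => ∃ v, D.Adj r v ∧ φ v = y
    | some x, none => ∃ v, D.Adj v r ∧ φ v = x
    | some x, some y => x ≠ y ∧ T x y = true⟩
  have key : ∀ u v, D.Adj r u → D.Adj v r → φ u ≠ φ v := by
    intro u v hu hv h
    have : u = v := h2 (hD.adj_iff.2 (Or.inl hu)) (hD.adj_iff.2 (Or.inr hv)) h
    exact hD.1.2 _ _ hu (this ▸ hv)
  have hH : H.IsOriented := by
    constructor
    · rintro (_ | x)
      · exact id
      · exact fun h => h.1 rfl
    · rintro (_ | x) (_ | y) h h'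
      · exact h
      · obtain ⟨u, hu, rfl⟩ := h
        obtain ⟨v, hv, he⟩ := h'
        exact key u v hu hv he.symm
      · obtain ⟨u, hu, rfl⟩ := h
        obtain ⟨v, hv, he⟩ := h'
        exact key v u hv hu he
      · have h3 : T x y = true := h.2
        have h4 : T y x = true := h'.2
        rw [hT x y h.1, h3] at h4
        exact absurd h4 (by simp)
  refine hH.orientedChromaticNumber_le_card ⟨fun v => if v = r then none else some (φ v), ?_⟩
  intro u v huv
  by_cases hu : u = r <;> by_cases hv : v = r
  · subst hu; subst hv
    exact absurd huv (hD.1.1 _)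
  · subst hu
    simp only [if_true, if_neg hv]
    exact ⟨v, huv, rfl⟩
  · subst hv
    simp only [if_true, if_neg hu]
    exact ⟨u, huv, rfl⟩
  · simp only [if_neg hu, if_neg hv]
    exact h1 u v hu hv huv

theorem SimpleGraph.Connected.orientedChromaticNumber_le {V : Type*} [Fintype V]
    {G : SimpleGraph V} [DecidableRel G.Adj] (hG : G.Connected) {m : ℕ} (hm : 26 ≤ m)
    (hdeg : G.maxDegree ≤ m + 3) :
    G.orientedChromaticNumber ≤ m * (m + 2) * 2 ^ (m + 3) + 1 := by
  set n := m * (m + 2) * 2 ^ (m + 3) with hn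
  have hcard : Fintype.card (Fin n) = n := Fintype.card_fin n
  obtain ⟨ω, hω⟩ := exists_tournament_lt_card_patternExtensions (V := Fin n) (k := m + 2)
    (by rw [hcard, hn]; exact pow_mul_one_sub_pow_lt_one hm)
  have hkn : m + 2 ≤ Fintype.card (Fin n) := by
    rw [hcard, hn]
    have : 1 ≤ m * 2 ^ (m + 3) := Nat.mul_pos (by omega) (by positivity)
    calc m + 2 ≤ (m * 2 ^ (m + 3)) * (m + 2) := Nat.le_mul_of_pos_left _ this
      _ = _ := by ring
  have := orientedChromaticNumber_le_card_add_one hG (k := m + 2)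
    (fun v => (G.degree_le_maxDegree v).trans hdeg)
    (fun u v => tournamentOfMatrix_swap ω) (le_card_patternExtensions hkn hω)
  rwa [hcard] at this

/-! ### Counting orientations. -/

/-- The orientation of `G` that turns an edge `e` upwards iff `σ e` holds. -/
def SimpleGraph.orientBy {V : Type*} [LinearOrder V] (G : SimpleGraph V)
    (σ : G.edgeSet → Bool) : Digraph V :=
  ⟨fun u v => ∃ h : G.Adj u v, σ ⟨s(u, v), h⟩ = decide (u < v)⟩

theorem SimpleGraph.orientBy_adj_swap {V : Type*} [LinearOrder V] {G : SimpleGraph V}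
    (σ : G.edgeSet → Bool) {u v : V} (h : G.Adj u v) :
    (G.orientBy σ).Adj v u ↔ ¬ (G.orientBy σ).Adj u v := by
  have e : (⟨s(v, u), h.symm⟩ : G.edgeSet) = ⟨s(u, v), h⟩ := Subtype.ext Sym2.eq_swap
  have h1 : (G.orientBy σ).Adj u v ↔ σ ⟨s(u, v), h⟩ = decide (u < v) :=
    ⟨fun h => h.2, fun h' => ⟨h, h'⟩⟩
  have h2 : (G.orientBy σ).Adj v u ↔ σ ⟨s(u, v), h⟩ = decide (v < u) := by
    rw [← e]
    exact ⟨fun h => h.2, fun h' => ⟨h.symm, h'⟩⟩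
  rw [h1, h2]
  rcases lt_or_gt_of_ne h.ne with h | h
  · rw [decide_eq_true h, decide_eq_false (not_lt_of_gt h)]; simp
  · rw [decide_eq_true h, decide_eq_false (not_lt_of_gt h)]; simp

theorem SimpleGraph.isOrientation_orientBy {V : Type*} [LinearOrder V] (G : SimpleGraph V)
    (σ : G.edgeSet → Bool) : G.IsOrientation (G.orientBy σ) := by
  refine ⟨⟨fun v h => h.1.ne rfl, fun u v h h' => ?_⟩, ?_⟩
  · exact (G.orientBy_adj_swap σ h.1).1 h' h
  · ext u v
    rw [Digraph.toSimpleGraphInclusive, SimpleGraph.fromRel_adj]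
    constructor
    · rintro ⟨-, h | h⟩
      exacts [h.1, h.1.symm]
    · exact fun h => ⟨h.ne, by rw [G.orientBy_adj_swap σ h]; exact em _⟩

theorem two_pow_card_edgeFinset_le {V : Type*} [Fintype V] [DecidableEq V] (G : SimpleGraph V)
    [DecidableRel G.Adj] {c : ℕ} (hc : G.orientedChromaticNumber ≤ c) :
    2 ^ G.edgeFinset.card ≤ c ^ Fintype.card V * 2 ^ (c * c) := by
  classical
  let _ : LinearOrder V := LinearOrder.lift' (Fintype.equivFin V) (Fintype.equivFin V).injective
  have hex : ∀ σ : G.edgeSet → Bool, ∃ (φ : V → Fin c) (M : Fin c × Fin c → Bool),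
      (∀ a b, M (a, b) = true → M (b, a) = false) ∧
      ∀ u v, (G.orientBy σ).Adj u v → M (φ u, φ v) = true := by
    intro σ
    have hσ := G.isOrientation_orientBy σ
    obtain ⟨H, hH, φ, hφ⟩ := hσ.1.isLeast_orientedChromaticNumber.1
    have hle : (G.orientBy σ).orientedChromaticNumber ≤ c :=
      (G.isGreatest_orientedChromaticNumber.2 ⟨_, hσ, rfl⟩).trans hc
    refine ⟨fun v => Fin.castLE hle (φ v),
      fun p => decide (∃ a b, H.Adj a b ∧ p = (Fin.castLE hle a, Fin.castLE hle b)), ?_, ?_⟩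
    · intro a b h
      obtain ⟨x, y, hxy, he⟩ := of_decide_eq_true h
      refine decide_eq_false ?_
      rintro ⟨y', x', hyx, he'⟩
      simp only [Prod.mk.injEq] at he he'
      have h1 : x' = x := Fin.castLE_injective hle (he'.2.symm.trans he.1)
      have h2 : y' = y := Fin.castLE_injective hle (he'.1.symm.trans he.2)
      subst h1; subst h2
      exact hH.2 _ _ hxy hyx
    · exact fun u v h => decide_eq_true ⟨_, _, hφ u v h, rfl⟩
  choose φ M hM hφ using hex
  -- If `σ` and `τ` differ on an edge, a shared pair would make `M` contain opposite arcs.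
  have hinj : Function.Injective fun σ => (φ σ, M σ) := by
    intro σ τ h
    simp only [Prod.mk.injEq] at h
    by_contra hne
    obtain ⟨⟨e, he⟩, hne⟩ := Function.ne_iff.1 hne
    induction e using Sym2.ind with
    | _ u v =>
    have he : G.Adj u v := he
    have key : ∀ u v, (G.orientBy σ).Adj u v → (G.orientBy τ).Adj v u → False := by
      intro u v h1 h2
      have h3 := hφ σ u v h1
      have h4 := hφ τ v u h2
      rw [← h.1, ← h.2, hM σ _ _ h3] at h4
      exact absurd h4 (by simp)
    have hst : ∀ ρ : G.edgeSet → Bool, (G.orientBy ρ).Adj u v ↔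
        ρ ⟨s(u, v), he⟩ = decide (u < v) := fun ρ => ⟨fun h => h.2, fun h' => ⟨he, h'⟩⟩
    by_cases h1 : (G.orientBy σ).Adj u v
    · refine key u v h1 ((G.orientBy_adj_swap τ he).2 fun h2 => hne ?_)
      rw [(hst σ).1 h1, (hst τ).1 h2]
    · by_cases h2 : (G.orientBy τ).Adj u v
      · exact key v u ((G.orientBy_adj_swap σ he).2 h1) h2
      · rw [hst] at h1 h2
        exact hne ((Bool.eq_not_of_ne h1).trans (Bool.eq_not_of_ne h2).symm)
  have hcard := Fintype.card_le_of_injective _ hinj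
  rw [Fintype.card_fun, Fintype.card_prod, Fintype.card_fun, Fintype.card_fun, Fintype.card_bool,
    Fintype.card_prod, Fintype.card_fin, ← SimpleGraph.edgeFinset_card] at hcard
  convert hcard

/-! ### Large connected regular graphs and the conclusion. -/

theorem exists_connected_regular (Δ : ℕ) (hΔ : 2 ≤ Δ) (m : ℕ) :
    ∃ (n : ℕ) (V : Type) (_ : Fintype V) (G : SimpleGraph V) (_ : DecidableRel G.Adj),
      m ≤ n ∧ Fintype.card V = n ∧ G.Connected ∧ G.IsRegularOfDegree Δ := by
  classical
  obtain ⟨d, rfl⟩ := Nat.exists_eq_add_of_le hΔ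
  let G : SimpleGraph (Fin (m + 3) × Fin (d + 1)) :=
    -- Degree `2` from the cycle plus `d` from the complete graph.
    (SimpleGraph.cycleGraph (m + 3)).boxProd (⊤ : SimpleGraph (Fin (d + 1)))
  refine ⟨(m + 3) * (d + 1), Fin (m + 3) × Fin (d + 1), inferInstance, G, Classical.decRel _,
    ?_, by simp, ?_, ?_⟩
  · nlinarith
  · exact SimpleGraph.cycleGraph_connected.boxProd SimpleGraph.connected_top
  · intro v
    have h := SimpleGraph.degree_boxProd (G := SimpleGraph.cycleGraph (m + 3))
      (H := (⊤ : SimpleGraph (Fin (d + 1)))) v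
    rw [SimpleGraph.cycleGraph_degree_three_le, SimpleGraph.complete_graph_degree] at h
    simp only [Fintype.card_fin, Nat.add_sub_cancel] at h
    rw [← h]
    congr!

theorem connectedOrientedChromaticNumbers_nonempty {Δ : ℕ} (hΔ : 2 ≤ Δ) :
    (connectedOrientedChromaticNumbers Δ).Nonempty := by
  classical
  obtain ⟨n, V, _, G, _, -, -, hG, hreg⟩ := exists_connected_regular Δ hΔ 0
  have := hG.nonempty
  refine ⟨_, V, inferInstance, G, hG, ?_, rfl⟩
  rw [← hreg.maxDegree_eq]
  congr!

theorem two_pow_le_sq_of_mem_upperBounds {Δ c : ℕ} (hΔ : 2 ≤ Δ)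
    (hc : c ∈ upperBounds (connectedOrientedChromaticNumbers Δ)) : 2 ^ Δ ≤ c ^ 2 := by
  classical
  by_contra! hlt
  have hN : ∀ N : ℕ, ∃ n, N ≤ n ∧ (2 ^ Δ) ^ n ≤ (c ^ 2) ^ n * 4 ^ (c * c) := by
    intro N
    obtain ⟨n, V, _, G, _, hn, hV, hG, hreg⟩ := exists_connected_regular Δ hΔ N
    have := hG.nonempty
    refine ⟨n, hn, ?_⟩
    have hχ : G.orientedChromaticNumber ≤ c := by
      refine hc ⟨V, inferInstance, G, hG, ?_, rfl⟩
      rw [← hreg.maxDegree_eq]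
      congr!
    have h1 := two_pow_card_edgeFinset_le G hχ
    have h2 := G.sum_degrees_eq_twice_card_edges
    simp only [hreg.degree_eq, Finset.sum_const, Finset.card_univ, hV, smul_eq_mul] at h2
    have h3 := Nat.pow_le_pow_left h1 2
    rw [hV] at h3
    calc (2 ^ Δ) ^ n = (2 ^ G.edgeFinset.card) ^ 2 := by
          rw [← pow_mul, ← pow_mul, mul_comm Δ, h2, mul_comm]
      _ ≤ _ := h3
      _ = _ := by
          rw [mul_pow, ← pow_mul, ← pow_mul, ← pow_mul, mul_comm n 2, mul_comm (c * c) 2,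
            pow_mul 2 2]; norm_num
  have hc0 : 0 < c := by
    by_contra! h
    obtain ⟨n, hn, h'⟩ := hN 1
    obtain rfl : c = 0 := by omega
    rw [zero_pow two_ne_zero, zero_pow (by omega), zero_mul] at h'
    have : 0 < (2 ^ Δ) ^ n := by positivity
    omega
  have hcR : (0 : ℝ) < (c : ℝ) ^ 2 := by positivity
  have hr : (1 : ℝ) < 2 ^ Δ / c ^ 2 := by
    rw [one_lt_div hcR]; exact_mod_cast hlt
  -- The factor `4 ^ (c * c)` does not depend on `n`, so large `n` gives a contradiction.
  obtain ⟨N, hN'⟩ := pow_unbounded_of_one_lt ((4 : ℝ) ^ (c * c)) hr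
  obtain ⟨n, hn, h⟩ := hN N
  have h1 : (4 : ℝ) ^ (c * c) < (2 ^ Δ / c ^ 2) ^ n :=
    hN'.trans_le (pow_le_pow_right₀ hr.le hn)
  rw [div_pow, lt_div_iff₀ (by positivity)] at h1
  have h2 : ((2 : ℝ) ^ Δ) ^ n ≤ ((c : ℝ) ^ 2) ^ n * 4 ^ (c * c) := by exact_mod_cast h
  linarith

theorem theorem3 (Δ : ℕ) (hΔ : 29 ≤ Δ) :
    ∃ χ : ℕ, IsGreatest (connectedOrientedChromaticNumbers Δ) χ ∧
      (2 : ℝ) ^ ((Δ : ℝ) / 2) ≤ (χ : ℝ) ∧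
      (χ : ℝ) ≤ ((Δ : ℝ) - 3) * ((Δ : ℝ) - 1) * 2 ^ Δ + 2 := by
  obtain ⟨m, rfl⟩ : ∃ m, Δ = m + 3 := ⟨Δ - 3, by omega⟩
  have hub : m * (m + 2) * 2 ^ (m + 3) + 1 ∈
      upperBounds (connectedOrientedChromaticNumbers (m + 3)) := by
    rintro _ ⟨V, _, G, hG, hdeg, rfl⟩
    classical
    exact hG.orientedChromaticNumber_le (by omega) hdeg.le
  have hne := connectedOrientedChromaticNumbers_nonempty (Δ := m + 3) (by omega)
  have hmem := Nat.sSup_mem hne ⟨_, hub⟩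
  refine ⟨_, ⟨hmem, fun x hx => le_csSup ⟨_, hub⟩ hx⟩, ?_, ?_⟩
  · have h := two_pow_le_sq_of_mem_upperBounds (Δ := m + 3) (by omega)
      fun x hx => le_csSup ⟨_, hub⟩ hx
    have h : ((2 : ℝ) ^ (((m + 3 : ℕ) : ℝ) / 2)) ^ 2 ≤
        ((sSup (connectedOrientedChromaticNumbers (m + 3)) : ℕ) : ℝ) ^ 2 := by
      rw [← Real.rpow_natCast, ← Real.rpow_mul (by norm_num), Nat.cast_ofNat,
        div_mul_cancel₀ _ (by norm_num), Real.rpow_natCast]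
      exact_mod_cast h
    exact le_of_sq_le_sq h (by positivity)
  · have h : ((sSup (connectedOrientedChromaticNumbers (m + 3)) : ℕ) : ℝ) ≤
        ((m * (m + 2) * 2 ^ (m + 3) + 1 : ℕ) : ℝ) := by exact_mod_cast hub hmem
    refine h.trans ?_
    push_cast
    have : ((m : ℝ) + 3 - 3) * (m + 3 - 1) = m * (m + 2) := by ring
    rw [this]
    linarith
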